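/- Let $(X,\mathfrak B,\mu)$ be a $\sigma$-finite non-atomic standard measure space, and let $\mathrm{Aut}(X,\mu)$ be the group of $\mu$-nonsingular invertible transformations of $X$ (identified when they agree $\mu$-a.e.). For $T\in\mathrm{Aut}(X,\mu)$ let $\mu\circ T$ be the measure $A\mapsto\mu(TA)$. Let $$\mathrm{Aut}_1(X,\mu)=\Big\{T\in\mathrm{Aut}(X,\mu) : \tfrac{d\mu\circ T}{d\mu}-1\in L^1(X,\mu)\Big\},\qquad \chi(T)=\int_X\Big(\tfrac{d\mu\circ T}{d\mu}-1\Big)\,d\mu .$$ Let $X^*$ be the space of counting measures on $X$ (countable sums of Dirac measures) with the $\sigma$-algebra generated by the maps $\omega\mapsto\omega(B)$, $B\in\mathfrak B$; let $\mu^*$ be the law on $X^*$ of the Poisson point process of intensity $\mu$; and for $T\in\mathrm{Aut}(X,\mu)$ let $T_*\omega=\omega\circ T^{-1}$, $\omega\in X^*$. A countable subgroup $\Lambda\subset\mathrm{Aut}(Y,\nu)$ is called conservative if for each measurable $B\subset Y$ with $\nu(B)>0$ and $\nu$-a.e. $y\in B$ there are infinitely many $\lambda\in\Lambda$ with $\lambda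 y\in B$. **Lemma.** Let $\Gamma$ be a countable subgroup of $\mathrm{Aut}_1(X,\mu)$ such that $\chi(\gamma)=0$ and $\big(\frac{d\mu}{d\mu\circ\gamma}\big)^2-1\in L^1(X,\mu)$ for each $\gamma\in\Gamma$. Suppose that there are positive reals $(b_\gamma)_{\gamma\in\Gamma}$ with $$\sum_{\gamma\in\Gamma}b_\gamma=\infty\qquad\text{and}\qquad \sum_{\gamma\in\Gamma}b_\gamma^2\exp\Big(\int_X\Big(\Big(\tfrac{d\mu}{d\mu\circ\gamma}\Big)^2-1\Big)d\mu\Big)<\infty .$$ Then $\gamma_*\in\mathrm{Aut}(X^*,\mu^*)$ for each $\gamma\in\Gamma$, the map $\gamma\mapsto\gamma_*$ is a homomorphism, and the Poisson suspension $\Gamma_*=\{\gamma_*:\gamma\in\Gamma\}$ is a conservative subgroup of $\mathrm{Aut}(X^*,\mu^*)$. -/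

import Mathlib

open MeasureTheory

noncomputable section

namespace PoissonSuspension

/-! ### Nonsingular transformations modulo null sets -/

/-- Invertible bimeasurable maps `T : X → X` such that `T` and `T⁻¹` pull null sets back to
null sets. -/
def nonsingularPerm {X : Type*} [MeasurableSpace X] (μ : Measure X) :
    Subgroup (Equiv.Perm X) where
  carrier := {T | Measure.QuasiMeasurePreserving T μ μ ∧
    Measure.QuasiMeasurePreserving T.symm μ μ}
  one_mem' := ⟨.id μ, .id μ⟩
  mul_mem' := fun hS hT => ⟨hS.1.comp hT.1, hT.2.comp hS.2⟩
  inv_mem' := fun hT => ⟨hT.2, hT.1⟩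

/-- The nonsingular transformations that are the identity almost everywhere. -/
def aeTrivial {X : Type*} [MeasurableSpace X] (μ : Measure X) :
    Subgroup (nonsingularPerm μ) where
  carrier := {T | ∀ᵐ x ∂μ, (T : Equiv.Perm X) x = x}
  one_mem' := by
    change ∀ᵐ x ∂μ, x = x
    exact Filter.Eventually.of_forall fun _ => rfl
  mul_mem' := by
    intro S T hS hT
    change ∀ᵐ x ∂μ, (S : Equiv.Perm X) ((T : Equiv.Perm X) x) = x
    filter_upwards [T.2.1.ae hS, hT] with x h1 h2
    rw [h1, h2]
  inv_mem' := by
    intro T hT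
    change ∀ᵐ x ∂μ, (T : Equiv.Perm X).symm x = x
    filter_upwards [T.2.2.ae hT] with x h
    rw [Equiv.apply_symm_apply] at h
    exact h.symm

instance {X : Type*} [MeasurableSpace X] (μ : Measure X) : (aeTrivial μ).Normal where
  conj_mem := by
    intro T hT S
    change ∀ᵐ x ∂μ,
      (S : Equiv.Perm X) ((T : Equiv.Perm X) ((S : Equiv.Perm X).symm x)) = x
    filter_upwards [S.2.2.ae hT] with x h
    rw [h, Equiv.apply_symm_apply]

/-- `Aut(X, μ)`: the group of nonsingular invertible transformations, two of them being identified
if they agree almost everywhere. -/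
abbrev Aut {X : Type*} [MeasurableSpace X] (μ : Measure X) : Type _ :=
  nonsingularPerm μ ⧸ aeTrivial μ

/-- A map representing an element of `Aut(X, μ)` (well defined up to a null set). -/
def Aut.rep {X : Type*} [MeasurableSpace X] {μ : Measure X} (T : Aut μ) : Equiv.Perm X :=
  (Quotient.out T : nonsingularPerm μ)

/-- The measure `μ ∘ T : A ↦ μ (T A)`, that is, the image of `μ` under `T⁻¹`. -/
def compAut {X : Type*} [MeasurableSpace X] (μ : Measure X) (T : Aut μ) : Measure X :=
  μ.map T.rep.symm

/-- `Aut₁(X, μ)`: those `T` for which `d(μ ∘ T)/dμ - 1` is `μ`-integrable. -/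
def Aut₁ {X : Type*} [MeasurableSpace X] (μ : Measure X) : Set (Aut μ) :=
  {T | Integrable (fun x => ((compAut μ T).rnDeriv μ x).toReal - 1) μ}

/-- `χ(T) = ∫ (d(μ ∘ T)/dμ - 1) dμ`. -/
def χ {X : Type*} [MeasurableSpace X] (μ : Measure X) (T : Aut μ) : ℝ :=
  ∫ x, (((compAut μ T).rnDeriv μ x).toReal - 1) ∂μ

/-- A (countable) subgroup `Γ` of `Aut(X, μ)` is conservative if, for every measurable `B` of
positive measure, almost every point of `B` returns to `B` under infinitely many elements
of `Γ`. -/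
def IsConservative {X : Type*} [MeasurableSpace X] {μ : Measure X} (Γ : Subgroup (Aut μ)) :
    Prop :=
  ∀ B : Set X, MeasurableSet B → 0 < μ B →
    ∀ᵐ x ∂μ, x ∈ B → {γ : Aut μ | γ ∈ Γ ∧ γ.rep x ∈ B}.Infinite

/-! ### The space of configurations and the Poisson measure -/

/-- `X*`: the counting measures on `X`, that is, the sums of countably many Dirac measures. -/
def Configuration (X : Type*) [MeasurableSpace X] : Type _ :=
  {ω : Measure X // ∃ (ι : Type) (_ : Countable ι) (x : ι → X),
    ω = Measure.sum fun i => Measure.dirac (x i)}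

/-- The σ-algebra on `X*` generated by the maps `ω ↦ ω(B)`, `B` measurable. -/
instance (X : Type*) [MeasurableSpace X] : MeasurableSpace (Configuration X) :=
  inferInstanceAs (MeasurableSpace {ω : Measure X // ∃ (ι : Type) (_ : Countable ι) (x : ι → X),
    ω = Measure.sum fun i => Measure.dirac (x i)})

/-- The configuration `δ_{x 0} + ⋯ + δ_{x (n - 1)}`. -/
def Configuration.ofPoints {X : Type*} [MeasurableSpace X] (n : ℕ) (x : Fin n → X) :
    Configuration X :=
  ⟨Measure.sum fun i => Measure.dirac (x i), Fin n, inferInstance, x, rfl⟩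

/-- The superposition of countably many configurations. -/
def Configuration.superpose {X : Type*} [MeasurableSpace X] (ω : ℕ → Configuration X) :
    Configuration X :=
  ⟨Measure.sum fun k => (ω k).1, by
    choose ι hι x hx using fun k => (ω k).2
    refine ⟨Σ k, ι k, inferInstance, fun p => x p.1 p.2, ?_⟩
    ext s hs
    simp_rw [hx]
    rw [Measure.sum_apply _ hs, Measure.sum_apply _ hs, ENNReal.tsum_sigma']
    exact tsum_congr fun k => Measure.sum_apply _ hs⟩

/-- The map `T_* : X* → X*` that sends a configuration to its image under a measurable map
`T`. -/
def Configuration.map {X : Type*} [MeasurableSpace X] (T : X → X) (hT : Measurable T)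
    (ω : Configuration X) : Configuration X :=
  ⟨ω.1.map T, by
    obtain ⟨ι, hι, x, hx⟩ := ω.2
    refine ⟨ι, hι, fun i => T (x i), ?_⟩
    rw [hx, Measure.map_sum hT.aemeasurable]
    simp_rw [Measure.map_dirac' hT]⟩

theorem measurable_ofPoints {X : Type*} [MeasurableSpace X] (n : ℕ) :
    Measurable (Configuration.ofPoints (X := X) n) := by
  refine Measurable.subtype_mk (Measure.measurable_of_measurable_coe _ fun s hs => ?_)
  simp_rw [Measure.sum_apply _ hs]
  exact Measurable.tsum fun i =>
    (Measure.measurable_coe hs).comp (Measure.measurable_dirac.comp (measurable_pi_apply i))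

theorem measurable_superpose {X : Type*} [MeasurableSpace X] :
    Measurable (Configuration.superpose (X := X)) := by
  refine Measurable.subtype_mk (Measure.measurable_of_measurable_coe _ fun s hs => ?_)
  simp_rw [Measure.sum_apply _ hs]
  exact Measurable.tsum fun k =>
    (Measure.measurable_coe hs).comp (measurable_subtype_coe.comp (measurable_pi_apply k))

/-- The law of the Poisson point process whose intensity is a finite measure `ν`:
`∑ n, e^{-ν(X)} / n! • (law of δ_{x 0} + ⋯ + δ_{x (n - 1)} under ν^n)`. -/
def finitePoisson {X : Type*} [MeasurableSpace X] (ν : Measure X) [IsFiniteMeasure ν] :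
    Measure (Configuration X) :=
  Measure.sum fun n : ℕ =>
    ENNReal.ofReal (Real.exp (-(ν.real Set.univ)) / n.factorial) •
      (Measure.pi fun _ : Fin n => ν).map (Configuration.ofPoints n)

instance {X : Type*} [MeasurableSpace X] (ν : Measure X) [IsFiniteMeasure ν] :
    IsProbabilityMeasure (finitePoisson ν) := by
  constructor
  have h : ∀ n : ℕ, (ENNReal.ofReal (Real.exp (-(ν.real Set.univ)) / n.factorial) •
      (Measure.pi fun _ : Fin n => ν).map (Configuration.ofPoints n)) Set.univ =
      ENNReal.ofReal (Real.exp (-(ν.real Set.univ)) *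
        ((ν.real Set.univ) ^ n / n.factorial)) := by
    intro n
    rw [Measure.smul_apply, Measure.map_apply (measurable_ofPoints n) MeasurableSet.univ,
      Set.preimage_univ, Measure.pi_univ, Finset.prod_const, Finset.card_univ, Fintype.card_fin,
      smul_eq_mul, ← ofReal_measureReal (μ := ν) (s := Set.univ),
      ← ENNReal.ofReal_pow measureReal_nonneg, ← ENNReal.ofReal_mul (by positivity)]
    congr 1
    ring
  have hs : HasSum (fun n : ℕ => Real.exp (-(ν.real Set.univ)) *
      ((ν.real Set.univ) ^ n / n.factorial)) 1 := by
    have h1 := (NormedSpace.expSeries_div_hasSum_exp (ν.real Set.univ)).mul_left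
      (Real.exp (-(ν.real Set.univ)))
    rwa [← Real.exp_eq_exp_ℝ, ← Real.exp_add, neg_add_cancel, Real.exp_zero] at h1
  rw [finitePoisson, Measure.sum_apply _ MeasurableSet.univ]
  simp_rw [h]
  rw [← ENNReal.ofReal_tsum_of_nonneg (fun n => by positivity) hs.summable, hs.tsum_eq,
    ENNReal.ofReal_one]

/-- `μ*`: the law of the Poisson point process of intensity `μ`. Writing `μ = ∑ k, μ_k` with finite
measures `μ_k`, it is the law of the superposition of independent Poisson point processes of
intensities `μ_k`. -/
def poisson {X : Type*} [MeasurableSpace X] (μ : Measure X) [SFinite μ] :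
    Measure (Configuration X) :=
  (Measure.infinitePi fun k : ℕ => finitePoisson (sfiniteSeq μ k)).map Configuration.superpose

instance {X : Type*} [MeasurableSpace X] (μ : Measure X) [SFinite μ] :
    IsProbabilityMeasure (poisson μ) :=
  Measure.isProbabilityMeasure_map measurable_superpose.aemeasurable

theorem Aut.measurable_rep {X : Type*} [MeasurableSpace X] {μ : Measure X} (T : Aut μ) :
    Measurable T.rep :=
  (Quotient.out T : nonsingularPerm μ).2.1.measurable

/-- `S ∈ Aut(X*, μ*)` is the Poisson suspension `T_*` of `T ∈ Aut(X, μ)`, that is,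
`S ω = ω ∘ T⁻¹` for almost every configuration `ω`. -/
def IsSuspension {X : Type*} [MeasurableSpace X] {μ : Measure X} [SFinite μ]
    (T : Aut μ) (S : Aut (poisson μ)) : Prop :=
  ∀ᵐ ω ∂(poisson μ), S.rep ω = Configuration.map T.rep T.measurable_rep ω

end PoissonSuspension

end

open PoissonSuspension

/-!
Let `P`, `Q` be the Poisson laws of equivalent intensities `μ`, `ν`, and let `q > 0`. If the
intensities are finite, Hölder's inequality on the `n`-point configurations, followed by Hölder's
inequality for the sum over `n`, gives
`P(D)^{q+1} ≤ exp (q ∫ (dν/dμ - 1) dμ + ∫ ((dμ/dν)^q - 1) dμ) Q(D)^q`.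
When `μ` is only σ-finite, restriction to windows of finite measure gives this inequality for the
sets `D` of configurations that depend on one window, and approximation gives it for all `D`.

Take `ν = μ ∘ γ`, so that `Q` is the image of `P = μ*` under `γ_*⁻¹`. The inequality shows that
`μ* ≪ Q`, which for `γ` and `γ⁻¹` together means that `γ_*` is nonsingular. Raised to the power
`1 / q`, the inequality bounds `b_γ` by a multiple of `Q(D) = μ*(γ_* D)` for all but finitely many
`γ`, so `∑ μ*(γ_* D) = ∞` whenever `μ*(D) > 0`. This is a sum over `Γ_*`, because `γ_*` determines
`γ` through the void probabilities `e^{-μ(A)}`. A countable group with this property is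
conservative, because the points that return to a set at most `m` times form a set whose translates
have total measure at most `m`.
-/

noncomputable section

namespace PoissonSuspension

open Filter Topology ProbabilityTheory
open scoped ENNReal

/-! ### Hölder's inequality -/

section Hoelder

variable {α : Type*} [MeasurableSpace α] {q : ℝ}

theorem lintegral_rpow_add_one_le (m : Measure α) (hq : 0 ≤ q) {f g h : α → ℝ≥0∞}
    (hf : AEMeasurable f m) (hg : AEMeasurable g m)
    (hle : ∀ x, h x ^ (q + 1) ≤ f x * g x ^ q) :
    (∫⁻ x, h x ∂m) ^ (q + 1) ≤ (∫⁻ x, f x ∂m) * (∫⁻ x, g x ∂m) ^ q := by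
  have hq1 : 0 < q + 1 := by linarith
  have mul_root (a c : ℝ≥0∞) :
      a ^ (q + 1)⁻¹ * c ^ (q * (q + 1)⁻¹) = (a * c ^ q) ^ (q + 1)⁻¹ := by
    rw [ENNReal.mul_rpow_of_nonneg _ _ (by positivity), ENNReal.rpow_mul]
  rw [← ENNReal.le_rpow_inv_iff hq1, ← mul_root]
  calc ∫⁻ x, h x ∂m ≤ ∫⁻ x, f x ^ (q + 1)⁻¹ * g x ^ (q * (q + 1)⁻¹) ∂m := by
        refine lintegral_mono fun x => ?_
        rw [mul_root, ENNReal.le_rpow_inv_iff hq1]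
        exact hle x
    _ ≤ _ := ENNReal.lintegral_mul_norm_pow_le hf hg (by positivity) (by positivity)
        (by field_simp; ring)

theorem tsum_rpow_add_one_le (hq : 0 ≤ q) {f g h : ℕ → ℝ≥0∞}
    (hle : ∀ n, h n ^ (q + 1) ≤ f n * g n ^ q) :
    (∑' n, h n) ^ (q + 1) ≤ (∑' n, f n) * (∑' n, g n) ^ q := by
  simpa only [lintegral_count] using lintegral_rpow_add_one_le Measure.count hq
    (measurable_from_nat (f := f)).aemeasurable (measurable_from_nat (f := g)).aemeasurable hle

theorem withDensity_rpow_add_one_le (m : Measure α) (hq : 0 ≤ q) {g : α → ℝ≥0∞}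
    (hg : Measurable g) {s : Set α} (hs : MeasurableSet s) :
    m.withDensity g s ^ (q + 1) ≤ (∫⁻ x, g x ^ (q + 1) ∂m) * m s ^ q := by
  have h := lintegral_rpow_add_one_le (m.restrict s) hq (hg.pow_const (q + 1)).aemeasurable
    (aemeasurable_const (b := 1)) (h := g) fun x => by simp
  rw [lintegral_one, Measure.restrict_apply_univ, ← withDensity_apply _ hs] at h
  exact h.trans (by gcongr; exact Measure.restrict_le_self)

end Hoelder

/-! ### Finite products of measures -/

section Pi

theorem lintegral_pi_prod {n : ℕ} {E : Fin n → Type*} [∀ i, MeasurableSpace (E i)]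
    (ν : ∀ i, Measure (E i)) [∀ i, SigmaFinite (ν i)] {f : ∀ i, E i → ℝ≥0∞}
    (hf : ∀ i, Measurable (f i)) :
    ∫⁻ x, ∏ i, f i (x i) ∂(Measure.pi ν) = ∏ i, ∫⁻ x, f i x ∂(ν i) := by
  induction n with
  | zero => simp
  | succ n ih =>
    have hprod : Measurable fun x : ∀ i : Fin n, E i.succ => ∏ i, f i.succ (x i) :=
      Finset.measurable_fun_prod _ fun i _ => (hf i.succ).comp (measurable_pi_apply i)
    rw [← ((measurePreserving_piFinSuccAbove ν 0).symm).lintegral_comp_emb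
      (MeasurableEquiv.measurableEmbedding _), Fin.prod_univ_succ,
      ← ih (fun i => ν i.succ) fun i => hf i.succ,
      ← lintegral_prod_mul (hf 0).aemeasurable hprod.aemeasurable]
    simp_rw [MeasurableEquiv.piFinSuccAbove_symm_apply, Fin.insertNthEquiv,
      Fin.prod_univ_succ, Fin.insertNth_zero, Equiv.coe_fn_mk, Fin.cons_succ, Fin.cons_zero]
    rfl

theorem pi_withDensity {n : ℕ} {E : Fin n → Type*} [∀ i, MeasurableSpace (E i)]
    (ν : ∀ i, Measure (E i)) [∀ i, SigmaFinite (ν i)] {g : ∀ i, E i → ℝ≥0∞}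
    (hg : ∀ i, Measurable (g i)) [∀ i, SigmaFinite ((ν i).withDensity (g i))] :
    (Measure.pi fun i => (ν i).withDensity (g i)) =
      (Measure.pi ν).withDensity fun x => ∏ i, g i (x i) := by
  classical
  refine Measure.pi_eq fun s hs => ?_
  have hind (x : ∀ i, E i) : (Set.univ.pi s).indicator (fun x => ∏ i, g i (x i)) x =
      ∏ i, (s i).indicator (g i) (x i) := by
    simp only [Set.indicator_apply, Set.mem_univ_pi, Finset.prod_ite_zero, Finset.mem_univ,
      true_imp_iff]
  rw [withDensity_apply _ (MeasurableSet.univ_pi hs),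
    ← lintegral_indicator (MeasurableSet.univ_pi hs)]
  simp_rw [hind, withDensity_apply _ (hs _)]
  rw [lintegral_pi_prod ν fun i => (hg i).indicator (hs i)]
  exact Finset.prod_congr rfl fun i _ => lintegral_indicator (hs i) _

theorem pi_withDensity_rpow_add_one_le {X : Type*} [MeasurableSpace X] (ν : Measure X)
    [SigmaFinite ν] {g : X → ℝ≥0∞} (hg : Measurable g) [SigmaFinite (ν.withDensity g)] {q : ℝ}
    (hq : 0 ≤ q) {n : ℕ} {s : Set (Fin n → X)} (hs : MeasurableSet s) :
    (Measure.pi fun _ => ν.withDensity g) s ^ (q + 1) ≤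
      (∫⁻ x, g x ^ (q + 1) ∂ν) ^ n * (Measure.pi fun _ => ν) s ^ q := by
  have hmoment : ∫⁻ x : Fin n → X, (∏ i, g (x i)) ^ (q + 1) ∂(Measure.pi fun _ => ν) =
      (∫⁻ x, g x ^ (q + 1) ∂ν) ^ n := by
    simp_rw [← ENNReal.prod_rpow_of_nonneg (add_nonneg hq zero_le_one)]
    rw [lintegral_pi_prod (fun _ => ν) fun _ => hg.pow_const (q + 1), Finset.prod_const,
      Finset.card_univ, Fintype.card_fin]
  rw [pi_withDensity _ fun _ => hg, ← hmoment]
  exact withDensity_rpow_add_one_le _ hq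
    (Finset.measurable_fun_prod _ fun i _ => hg.comp (measurable_pi_apply i)) hs

end Pi

/-! ### The function `t ↦ e^{-t}` on `[0, ∞]` -/

/-- The function `t ↦ e^{-t}` on `[0, ∞]`, with `e^{-∞} = 0`. -/
def expNeg (t : ℝ≥0∞) : ℝ≥0∞ := EReal.exp (-(t : EReal))

theorem expNeg_zero : expNeg 0 = 1 := by simp [expNeg]

theorem expNeg_top : expNeg ∞ = 0 := by simp [expNeg]

theorem expNeg_ofReal {x : ℝ} (hx : 0 ≤ x) :
    expNeg (ENNReal.ofReal x) = ENNReal.ofReal (Real.exp (-x)) := by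
  rw [expNeg, EReal.coe_ennreal_ofReal, max_eq_left hx, ← EReal.coe_neg, EReal.exp_coe]

theorem expNeg_add (s t : ℝ≥0∞) : expNeg (s + t) = expNeg s * expNeg t := by
  rw [expNeg, expNeg, expNeg, ← EReal.exp_add, EReal.coe_ennreal_add,
    EReal.neg_add (Or.inl (EReal.coe_ennreal_ne_bot s)) (Or.inr (EReal.coe_ennreal_ne_bot t)),
    sub_eq_add_neg]

theorem expNeg_sum {ι : Type*} (s : Finset ι) (f : ι → ℝ≥0∞) :
    expNeg (∑ i ∈ s, f i) = ∏ i ∈ s, expNeg (f i) := by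
  classical
  induction s using Finset.induction_on with
  | empty => simp [expNeg_zero]
  | insert a s ha ih => rw [Finset.sum_insert ha, Finset.prod_insert ha, expNeg_add, ih]

theorem expNeg_natCast_mul (n : ℕ) (t : ℝ≥0∞) : expNeg (n * t) = expNeg t ^ n := by
  simpa using expNeg_sum (Finset.range n) fun _ => t

theorem expNeg_strictAnti : StrictAnti expNeg := fun _ _ h =>
  EReal.exp_strictMono (EReal.neg_lt_neg_iff.2 (EReal.coe_ennreal_lt_coe_ennreal_iff.2 h))

theorem expNeg_le_one (t : ℝ≥0∞) : expNeg t ≤ 1 :=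
  expNeg_zero ▸ expNeg_strictAnti.antitone (zero_le (a := t))

theorem expNeg_ne_top (t : ℝ≥0∞) : expNeg t ≠ ∞ :=
  ((expNeg_le_one t).trans_lt ENNReal.one_lt_top).ne

theorem continuous_expNeg : Continuous expNeg :=
  ENNReal.continuous_exp.comp (continuous_neg.comp continuous_coe_ennreal_ereal)

theorem measurable_expNeg : Measurable expNeg := continuous_expNeg.measurable

theorem tendsto_prod_expNeg (f : ℕ → ℝ≥0∞) :
    Tendsto (fun n => ∏ k ∈ Finset.range n, expNeg (f k)) atTop (𝓝 (expNeg (∑' k, f k))) := by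
  simp_rw [← expNeg_sum]
  exact (continuous_expNeg.tendsto _).comp ENNReal.summable.hasSum.tendsto_sum_nat

/-! ### Poisson laws and their Laplace functionals -/

namespace Configuration

variable {X : Type*} [MeasurableSpace X]

/-- The Laplace functional `ω ↦ e^{-∫ g dω}` of a point process. -/
def laplace (g : X → ℝ≥0∞) (ω : Configuration X) : ℝ≥0∞ := expNeg (∫⁻ x, g x ∂ω.1)

theorem measurable_laplace {g : X → ℝ≥0∞} (hg : Measurable g) : Measurable (laplace g) :=
  measurable_expNeg.comp ((Measure.measurable_lintegral hg).comp measurable_subtype_coe)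

theorem laplace_ofPoints {g : X → ℝ≥0∞} (hg : Measurable g) {n : ℕ} (x : Fin n → X) :
    laplace g (ofPoints n x) = ∏ i, expNeg (g (x i)) := by
  rw [laplace, ofPoints, lintegral_sum_measure, tsum_fintype, expNeg_sum]
  simp_rw [lintegral_dirac' _ hg]

theorem tendsto_prod_laplace (g : X → ℝ≥0∞) (ω : ℕ → Configuration X) :
    Tendsto (fun n => ∏ k ∈ Finset.range n, laplace g (ω k)) atTop
      (𝓝 (laplace g (superpose ω))) := by
  have h := tendsto_prod_expNeg fun k => ∫⁻ x, g x ∂(ω k).1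
  rwa [← lintegral_sum_measure] at h

theorem measurable_apply {B : Set X} (hB : MeasurableSet B) :
    Measurable fun ω : Configuration X => ω.1 B :=
  (Measure.measurable_coe hB).comp measurable_subtype_coe

theorem measurable_map {T : X → X} (hT : Measurable T) : Measurable (map T hT) := by
  refine Measurable.subtype_mk (Measure.measurable_of_measurable_coe _ fun s hs => ?_)
  simp_rw [Measure.map_apply hT hs]
  exact measurable_apply (hT hs)

/-- The restriction of a configuration to a measurable set. -/
def restrict (B : Set X) (hB : MeasurableSet B) (ω : Configuration X) : Configuration X :=
  ⟨ω.1.restrict B, by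
    classical
    obtain ⟨ι, hι, x, hx⟩ := ω.2
    refine ⟨{i : ι // x i ∈ B}, inferInstance, fun i => x i, ?_⟩
    rw [hx, Measure.restrict_sum _ hB]
    ext s hs
    rw [Measure.sum_apply _ hs, Measure.sum_apply _ hs]
    simp_rw [restrict_dirac' hB]
    rw [← tsum_subtype_eq_of_support_subset (s := {i | x i ∈ B})]
    · exact tsum_congr fun i => by rw [if_pos (show x i ∈ B from i.2)]
    · intro i hi
      by_contra h
      exact hi (by simp [show x i ∉ B from h])⟩

theorem measurable_restrict {B : Set X} (hB : MeasurableSet B) :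
    Measurable (restrict B hB) := by
  refine Measurable.subtype_mk (Measure.measurable_of_measurable_coe _ fun s hs => ?_)
  simp_rw [Measure.restrict_apply hs]
  exact measurable_apply (hs.inter hB)

theorem restrict_restrict {A B : Set X} (hA : MeasurableSet A) (hB : MeasurableSet B)
    (hAB : A ⊆ B) (ω : Configuration X) :
    restrict A hA (restrict B hB ω) = restrict A hA ω :=
  Subtype.ext (Measure.restrict_restrict_of_subset hAB)

end Configuration

/-- `P` has the Laplace functional of the Poisson point process of intensity `μ`. This is how
Poisson laws are recognised below; see `IsPoissonLaw.unique`. -/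
def IsPoissonLaw {X : Type*} [MeasurableSpace X] (P : Measure (Configuration X))
    (μ : Measure X) : Prop :=
  ∀ g : X → ℝ≥0∞, Measurable g →
    ∫⁻ ω, Configuration.laplace g ω ∂P = expNeg (∫⁻ x, (1 - expNeg (g x)) ∂μ)

/-- The weight `e^{-a} / n!` of the configurations of `n` points in a Poisson law of total
intensity `a`. -/
def poissonWeight (a : ℝ) (n : ℕ) : ℝ≥0∞ := ENNReal.ofReal (Real.exp (-a) / n.factorial)

theorem tsum_poissonWeight_mul_pow (a : ℝ) {c : ℝ≥0∞} (hc : c ≠ ∞) :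
    ∑' n, poissonWeight a n * c ^ n = ENNReal.ofReal (Real.exp (c.toReal - a)) := by
  have hs : HasSum (fun n : ℕ => Real.exp (-a) * (c.toReal ^ n / n.factorial))
      (Real.exp (c.toReal - a)) := by
    have h1 := (NormedSpace.expSeries_div_hasSum_exp c.toReal).mul_left (Real.exp (-a))
    rwa [← Real.exp_eq_exp_ℝ, ← Real.exp_add, neg_add_eq_sub] at h1
  rw [← hs.tsum_eq, ENNReal.ofReal_tsum_of_nonneg (fun n => by positivity) hs.summable]
  refine tsum_congr fun n => ?_
  rw [mul_div_left_comm, mul_comm, ENNReal.ofReal_mul (by positivity),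
    ENNReal.ofReal_pow ENNReal.toReal_nonneg, ENNReal.ofReal_toReal hc, poissonWeight]

theorem poissonWeight_rpow_add_one (a a' : ℝ) {q : ℝ} (hq : 0 ≤ q) (n : ℕ) :
    poissonWeight a n ^ (q + 1) =
      poissonWeight ((q + 1) * a - q * a') n * poissonWeight a' n ^ q := by
  have hn : (0 : ℝ) ≤ n.factorial := by positivity
  simp only [poissonWeight]
  rw [ENNReal.ofReal_rpow_of_nonneg (by positivity) (by positivity),
    ENNReal.ofReal_rpow_of_nonneg (by positivity) hq, ← ENNReal.ofReal_mul (by positivity),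
    Real.div_rpow (Real.exp_pos _).le hn, Real.div_rpow (Real.exp_pos _).le hn,
    ← Real.exp_mul, ← Real.exp_mul, div_mul_div_comm, ← Real.exp_add,
    Real.rpow_add_one (by positivity), mul_comm ((n.factorial : ℝ) ^ q)]
  congr 3
  ring

section

variable {X : Type*} [MeasurableSpace X] (ν : Measure X) [IsFiniteMeasure ν]

theorem lintegral_finitePoisson {F : Configuration X → ℝ≥0∞} (hF : Measurable F) :
    ∫⁻ ω, F ω ∂(finitePoisson ν) = ∑' n : ℕ, poissonWeight (ν.real Set.univ) n *
      ∫⁻ x, F (Configuration.ofPoints n x) ∂(Measure.pi fun _ : Fin n => ν) := by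
  rw [finitePoisson, lintegral_sum_measure]
  simp_rw [lintegral_smul_measure, lintegral_map hF (measurable_ofPoints _)]
  rfl

theorem finitePoisson_apply {D : Set (Configuration X)} (hD : MeasurableSet D) :
    finitePoisson ν D = ∑' n : ℕ, poissonWeight (ν.real Set.univ) n *
      (Measure.pi fun _ : Fin n => ν) (Configuration.ofPoints n ⁻¹' D) := by
  rw [finitePoisson, Measure.sum_apply _ hD]
  simp_rw [Measure.smul_apply, Measure.map_apply (measurable_ofPoints _) hD]
  rfl

theorem isPoissonLaw_finitePoisson : IsPoissonLaw (finitePoisson ν) ν := by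
  intro g hg
  have hm : Measurable fun x => expNeg (g x) := measurable_expNeg.comp hg
  have hle : ∫⁻ x, expNeg (g x) ∂ν ≤ ν Set.univ :=
    (lintegral_mono fun x => expNeg_le_one (g x)).trans_eq (by simp)
  have hc : ∫⁻ x, expNeg (g x) ∂ν ≠ ∞ := (hle.trans_lt (measure_lt_top ν _)).ne
  have hpow (n : ℕ) : ∫⁻ x : Fin n → X, ∏ i, expNeg (g (x i)) ∂(Measure.pi fun _ => ν) =
      (∫⁻ x, expNeg (g x) ∂ν) ^ n := by
    rw [lintegral_pi_prod (fun _ => ν) fun _ => hm, Finset.prod_const, Finset.card_univ,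
      Fintype.card_fin]
  rw [lintegral_finitePoisson ν (Configuration.measurable_laplace hg)]
  simp_rw [Configuration.laplace_ofPoints hg, hpow]
  rw [tsum_poissonWeight_mul_pow _ hc, lintegral_sub hm hc
    (Eventually.of_forall fun x => expNeg_le_one (g x)), lintegral_one,
    ← ENNReal.ofReal_toReal (ENNReal.sub_ne_top (measure_ne_top ν _)),
    expNeg_ofReal ENNReal.toReal_nonneg, ENNReal.toReal_sub_of_le hle (measure_ne_top ν _),
    neg_sub, measureReal_def]

end

section

variable {X : Type*} [MeasurableSpace X]

theorem tendsto_prod_lintegral_laplace (P : ℕ → Measure (Configuration X))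
    [∀ k, IsProbabilityMeasure (P k)] {g : X → ℝ≥0∞} (hg : Measurable g) :
    Tendsto (fun n => ∏ k ∈ Finset.range n, ∫⁻ ω, Configuration.laplace g ω ∂(P k)) atTop
      (𝓝 (∫⁻ ω, Configuration.laplace g ω
        ∂((Measure.infinitePi P).map Configuration.superpose))) := by
  have hlap := Configuration.measurable_laplace hg
  have hcoord (k : ℕ) :
      Measurable fun ω : ℕ → Configuration X => Configuration.laplace g (ω k) :=
    hlap.comp (measurable_pi_apply k)
  have hindep (n : ℕ) : ∏ k ∈ Finset.range n, ∫⁻ ω, Configuration.laplace g ω ∂(P k) =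
      ∫⁻ ω, ∏ k ∈ Finset.range n, Configuration.laplace g (ω k) ∂(Measure.infinitePi P) := by
    rw [lintegral_prod_eq_prod_lintegral_of_indepFun (Finset.range n)
      (fun k (ω : ℕ → Configuration X) => Configuration.laplace g (ω k))
      (iIndepFun_infinitePi fun _ => hlap) hcoord]
    refine Finset.prod_congr rfl fun k _ => ?_
    rw [← Measure.infinitePi_map_eval P k, lintegral_map hlap (measurable_pi_apply k)]
  simp_rw [hindep]
  rw [lintegral_map hlap measurable_superpose]
  exact tendsto_lintegral_of_dominated_convergence (fun _ => 1)
    (fun n => Finset.measurable_prod _ fun k _ => hcoord k)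
    (fun n => Eventually.of_forall fun ω => Finset.prod_le_one' fun k _ => expNeg_le_one _)
    (by simp) (Eventually.of_forall (Configuration.tendsto_prod_laplace g))

theorem IsPoissonLaw.superpose {P : ℕ → Measure (Configuration X)}
    [∀ k, IsProbabilityMeasure (P k)] {μ : ℕ → Measure X} (h : ∀ k, IsPoissonLaw (P k) (μ k)) :
    IsPoissonLaw ((Measure.infinitePi P).map Configuration.superpose) (Measure.sum μ) := by
  intro g hg
  have hlim := tendsto_prod_lintegral_laplace P hg
  simp_rw [h _ g hg] at hlim
  rw [lintegral_sum_measure]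
  exact tendsto_nhds_unique hlim (tendsto_prod_expNeg _)

theorem isPoissonLaw_poisson (μ : Measure X) [SFinite μ] : IsPoissonLaw (poisson μ) μ := by
  have h := IsPoissonLaw.superpose fun k => isPoissonLaw_finitePoisson (sfiniteSeq μ k)
  rwa [sum_sfiniteSeq] at h

end

namespace IsPoissonLaw

variable {X : Type*} [MeasurableSpace X] {P : Measure (Configuration X)} {μ : Measure X}
  (hP : IsPoissonLaw P μ)

include hP

theorem isProbabilityMeasure : IsProbabilityMeasure P := by
  constructor
  simpa [Configuration.laplace, expNeg_zero] using hP 0 measurable_zero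

theorem map {T : X → X} (hT : Measurable T) :
    IsPoissonLaw (P.map (Configuration.map T hT)) (μ.map T) := by
  intro g hg
  have hm : Measurable fun x => 1 - expNeg (g x) :=
    measurable_const.sub (measurable_expNeg.comp hg)
  rw [lintegral_map (Configuration.measurable_laplace hg) (Configuration.measurable_map hT),
    lintegral_map hm hT]
  refine Eq.trans (lintegral_congr fun ω => ?_) (hP _ (hg.comp hT))
  rw [Configuration.laplace, Configuration.laplace, Configuration.map, lintegral_map hg hT]

theorem restrict {B : Set X} (hB : MeasurableSet B) :
    IsPoissonLaw (P.map (Configuration.restrict B hB)) (μ.restrict B) := by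
  intro g hg
  rw [lintegral_map (Configuration.measurable_laplace hg) (Configuration.measurable_restrict hB),
    ← lintegral_indicator hB]
  have hlap (ω : Configuration X) : Configuration.laplace g (Configuration.restrict B hB ω) =
      Configuration.laplace (B.indicator g) ω := by
    rw [Configuration.laplace, Configuration.laplace, Configuration.restrict,
      lintegral_indicator hB]
  simp_rw [hlap]
  rw [hP _ (hg.indicator hB)]
  congr 1
  refine lintegral_congr fun x => ?_
  by_cases hx : x ∈ B <;> simp [hx, expNeg_zero]

theorem measure_apply_eq_zero {A : Set X} (hA : MeasurableSet A) :
    P {ω | ω.1 A = 0} = expNeg (μ A) := by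
  have h := hP (A.indicator fun _ => ∞) (measurable_const.indicator hA)
  have hlap (ω : Configuration X) : Configuration.laplace (A.indicator fun _ => ∞) ω =
      {ω : Configuration X | ω.1 A = 0}.indicator 1 ω := by
    rw [Configuration.laplace, lintegral_indicator_const hA]
    by_cases hω : ω.1 A = 0
    · simp [hω, expNeg_zero]
    · simp [hω, expNeg_top]
  have hind (x : X) : 1 - expNeg (A.indicator (fun _ => ∞) x) = A.indicator 1 x := by
    by_cases hx : x ∈ A <;> simp [hx, expNeg_zero, expNeg_top]
  have hm : MeasurableSet {ω : Configuration X | ω.1 A = 0} :=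
    Configuration.measurable_apply hA (measurableSet_singleton 0)
  simp_rw [hlap, hind] at h
  rwa [lintegral_indicator_one hA, lintegral_indicator_one hm] at h

theorem ae_apply_eq_zero {A : Set X} (hA : μ A = 0) : ∀ᵐ ω ∂P, ω.1 A = 0 := by
  have := hP.isProbabilityMeasure
  have hm : MeasurableSet (toMeasurable μ A) := measurableSet_toMeasurable μ A
  have h : P {ω | ω.1 (toMeasurable μ A) = 0} = 1 := by
    rw [hP.measure_apply_eq_zero hm, measure_toMeasurable, hA, expNeg_zero]
  have h' : ∀ᵐ ω ∂P, ω.1 (toMeasurable μ A) = 0 :=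
    (prob_compl_eq_zero_iff (Configuration.measurable_apply hm (measurableSet_singleton 0))).2 h
  filter_upwards [h'] with ω hω
  exact measure_mono_null (subset_toMeasurable μ A) hω

end IsPoissonLaw

/-! ### The Laplace functional determines the law -/

section Uniqueness

variable {S : Type*}

/-- The function `x ↦ e^{-x i}` on `[0, ∞]^S`, as a bounded continuous function. These functions
generate a subalgebra that separates points. -/
def expNegCoord (i : S) : BoundedContinuousFunction (S → ℝ≥0∞) ℝ :=
  BoundedContinuousFunction.ofNormedAddCommGroup (fun x => (expNeg (x i)).toReal)
    (ENNReal.continuousOn_toReal.comp_continuous (continuous_expNeg.comp (continuous_apply i))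
      fun _ => expNeg_ne_top _)
    1 fun x => by
      rw [Real.norm_of_nonneg ENNReal.toReal_nonneg]
      exact ENNReal.toReal_mono ENNReal.one_ne_top (expNeg_le_one _)

theorem expNegCoord_apply (i : S) (x : S → ℝ≥0∞) : expNegCoord i x = (expNeg (x i)).toReal := rfl

theorem exists_expNegCoord_ne {x y : S → ℝ≥0∞} (h : x ≠ y) :
    ∃ i, expNegCoord i x ≠ expNegCoord i y := by
  obtain ⟨i, hi⟩ := Function.ne_iff.1 h
  refine ⟨i, fun heq => hi (expNeg_strictAnti.injective ?_)⟩
  exact (ENNReal.toReal_eq_toReal_iff' (expNeg_ne_top _) (expNeg_ne_top _)).1 heq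

variable [Fintype S]

theorem measurable_prod_expNeg_pow (n : S → ℕ) :
    Measurable fun x : S → ℝ≥0∞ => ∏ i, expNeg (x i) ^ n i :=
  Finset.measurable_fun_prod _ fun i _ =>
    (measurable_expNeg.comp (measurable_pi_apply i)).pow_const _

theorem prod_expNeg_pow_lt_top (n : S → ℕ) (x : S → ℝ≥0∞) : ∏ i, expNeg (x i) ^ n i < ∞ :=
  (Finset.prod_le_one' fun _ _ => pow_le_one' (expNeg_le_one _) _).trans_lt ENNReal.one_lt_top

theorem exists_eq_prod_of_mem_closure_expNegCoord
    {m : BoundedContinuousFunction (S → ℝ≥0∞) ℝ}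
    (hm : m ∈ Submonoid.closure (Set.range (expNegCoord (S := S)))) :
    ∃ n : S → ℕ, ∀ x, m x = (∏ i, expNeg (x i) ^ n i).toReal := by
  classical
  induction hm using Submonoid.closure_induction with
  | mem m hm =>
    obtain ⟨j, rfl⟩ := hm
    refine ⟨Pi.single j 1, fun x => ?_⟩
    rw [Finset.prod_eq_single j (fun i _ hi => by simp [hi]) (by simp), expNegCoord_apply]
    simp
  | one => exact ⟨0, fun x => by simp⟩
  | mul m m' _ _ h h' =>
    obtain ⟨n, hn⟩ := h
    obtain ⟨n', hn'⟩ := h'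
    refine ⟨n + n', fun x => ?_⟩
    rw [BoundedContinuousFunction.mul_apply, hn, hn', ← ENNReal.toReal_mul,
      ← Finset.prod_mul_distrib]
    simp_rw [Pi.add_apply, pow_add]

variable {P Q : Measure (S → ℝ≥0∞)} [IsFiniteMeasure P] [IsFiniteMeasure Q]

theorem integral_eq_of_mem_adjoin_expNegCoord
    (h : ∀ n : S → ℕ, ∫⁻ x, ∏ i, expNeg (x i) ^ n i ∂P = ∫⁻ x, ∏ i, expNeg (x i) ^ n i ∂Q)
    {f : BoundedContinuousFunction (S → ℝ≥0∞) ℝ}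
    (hf : f ∈ Algebra.adjoin ℝ (Set.range (expNegCoord (S := S)))) :
    ∫ x, f x ∂P = ∫ x, f x ∂Q := by
  rw [← Subalgebra.mem_toSubmodule, Algebra.adjoin_eq_span] at hf
  induction hf using Submodule.span_induction with
  | mem m hm =>
    obtain ⟨n, hn⟩ := exists_eq_prod_of_mem_closure_expNegCoord hm
    have hlt (R : Measure (S → ℝ≥0∞)) := ae_of_all R (prod_expNeg_pow_lt_top n)
    simp_rw [hn]
    rw [integral_toReal (measurable_prod_expNeg_pow n).aemeasurable (hlt _),
      integral_toReal (measurable_prod_expNeg_pow n).aemeasurable (hlt _), h]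
  | zero => simp
  | add f g _ _ hf hg =>
    simp only [BoundedContinuousFunction.add_apply]
    rw [integral_add (f.integrable _) (g.integrable _),
      integral_add (f.integrable _) (g.integrable _), hf, hg]
  | smul c f _ hf =>
    simp only [BoundedContinuousFunction.smul_apply]
    rw [integral_smul, integral_smul, hf]

theorem ext_of_lintegral_prod_expNeg_pow
    (h : ∀ n : S → ℕ, ∫⁻ x, ∏ i, expNeg (x i) ^ n i ∂P = ∫⁻ x, ∏ i, expNeg (x i) ^ n i ∂Q) :
    P = Q := by
  let A : StarSubalgebra ℝ (BoundedContinuousFunction (S → ℝ≥0∞) ℝ) :=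
    { Algebra.adjoin ℝ (Set.range (expNegCoord (S := S))) with
      star_mem' := fun {a} ha => by rwa [show star a = a by ext x; simp] }
  refine ext_of_forall_mem_subalgebra_integral_eq_of_polish (𝕜 := ℝ) (A := A) ?_
    fun f hf => integral_eq_of_mem_adjoin_expNegCoord h hf
  intro x y hxy
  obtain ⟨i, hi⟩ := exists_expNegCoord_ne hxy
  exact ⟨expNegCoord i, ⟨(expNegCoord i).toContinuousMap, ⟨expNegCoord i,
    Algebra.subset_adjoin ⟨i, rfl⟩, rfl⟩, rfl⟩, hi⟩

end Uniqueness

namespace Configuration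

variable {X : Type*} [MeasurableSpace X]

/-- The values of a configuration on all measurable sets. -/
def values (ω : Configuration X) : {B : Set X // MeasurableSet B} → ℝ≥0∞ := fun B => ω.1 B

theorem measurable_values : Measurable (values (X := X)) :=
  measurable_pi_lambda _ fun B => measurable_apply B.2

theorem measurableSpace_eq_comap_values :
    (inferInstance : MeasurableSpace (Configuration X)) =
      MeasurableSpace.comap values MeasurableSpace.pi := by
  refine le_antisymm ?_ measurable_values.comap_le
  refine Measurable.comap_le (Measure.measurable_of_measurable_coe _ fun B hB => ?_)
  exact (measurable_pi_apply (⟨B, hB⟩ : {B : Set X // MeasurableSet B})).comp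
    (comap_measurable values)

theorem ext_of_map_values {P Q : Measure (Configuration X)} (h : P.map values = Q.map values) :
    P = Q := by
  refine Measure.ext fun s hs => ?_
  obtain ⟨t, ht, rfl⟩ := measurableSpace_eq_comap_values.le s hs
  rw [← Measure.map_apply measurable_values ht, h, Measure.map_apply measurable_values ht]

/-- The step function `∑ B ∈ S, n(B) 1_B`. -/
def stepFunction {S : Finset {B : Set X // MeasurableSet B}} (n : S → ℕ) (x : X) : ℝ≥0∞ :=
  ∑ B : S, B.1.1.indicator (fun _ => (n B : ℝ≥0∞)) x

variable {S : Finset {B : Set X // MeasurableSet B}} (n : S → ℕ)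

theorem measurable_stepFunction : Measurable (stepFunction n) :=
  Finset.measurable_fun_sum _ fun B _ => measurable_const.indicator B.1.2

theorem prod_expNeg_values_pow (ω : Configuration X) :
    ∏ B : S, expNeg (S.restrict (values ω) B) ^ n B = laplace (stepFunction n) ω := by
  simp only [laplace, stepFunction]
  rw [lintegral_finsetSum _ fun B _ => measurable_const.indicator B.1.2, expNeg_sum]
  refine Finset.prod_congr rfl fun B _ => ?_
  rw [lintegral_indicator_const B.1.2, expNeg_natCast_mul]
  rfl

theorem lintegral_prod_expNeg_pow_map_values (P : Measure (Configuration X)) :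
    ∫⁻ x, ∏ B, expNeg (x B) ^ n B ∂((P.map values).map S.restrict) =
      ∫⁻ ω, laplace (stepFunction n) ω ∂P := by
  rw [Measure.map_map (Finset.measurable_restrict S) measurable_values,
    lintegral_map (measurable_prod_expNeg_pow n)
      ((Finset.measurable_restrict S).comp measurable_values)]
  exact lintegral_congr (prod_expNeg_values_pow n)

theorem ext_of_lintegral_laplace {P Q : Measure (Configuration X)} [IsFiniteMeasure P]
    [IsFiniteMeasure Q] (h : ∀ g : X → ℝ≥0∞, Measurable g →
      ∫⁻ ω, laplace g ω ∂P = ∫⁻ ω, laplace g ω ∂Q) : P = Q := by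
  refine ext_of_map_values (IsProjectiveLimit.unique
    (P := fun S => (Q.map values).map S.restrict) (fun S => ?_) fun S => rfl)
  refine ext_of_lintegral_prod_expNeg_pow fun n => ?_
  rw [lintegral_prod_expNeg_pow_map_values, lintegral_prod_expNeg_pow_map_values]
  exact h _ (measurable_stepFunction n)

end Configuration

namespace IsPoissonLaw

variable {X : Type*} [MeasurableSpace X] {P Q : Measure (Configuration X)} {μ : Measure X}

theorem unique (hP : IsPoissonLaw P μ) (hQ : IsPoissonLaw Q μ) : P = Q := by
  have := hP.isProbabilityMeasure
  have := hQ.isProbabilityMeasure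
  exact Configuration.ext_of_lintegral_laplace fun g hg => (hP g hg).trans (hQ g hg).symm

theorem eq_finitePoisson [IsFiniteMeasure μ] (hP : IsPoissonLaw P μ) : P = finitePoisson μ :=
  hP.unique (isPoissonLaw_finitePoisson μ)

end IsPoissonLaw

/-! ### Hölder's inequality for Poisson laws of finite intensity -/

section

variable {X : Type*} [MeasurableSpace X] {ν : Measure X} [IsFiniteMeasure ν] {g : X → ℝ≥0∞}
  [IsFiniteMeasure (ν.withDensity g)] {q : ℝ}

theorem finitePoisson_withDensity_rpow_add_one_le (hg : Measurable g) (hq : 0 ≤ q)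
    (hgq : ∫⁻ x, g x ^ (q + 1) ∂ν ≠ ∞) {D : Set (Configuration X)} (hD : MeasurableSet D) :
    finitePoisson (ν.withDensity g) D ^ (q + 1) ≤
      ENNReal.ofReal (Real.exp ((∫⁻ x, g x ^ (q + 1) ∂ν).toReal -
        ((q + 1) * (ν.withDensity g).real Set.univ - q * ν.real Set.univ))) *
      finitePoisson ν D ^ q := by
  rw [finitePoisson_apply _ hD, finitePoisson_apply _ hD, ← tsum_poissonWeight_mul_pow _ hgq]
  refine tsum_rpow_add_one_le hq fun n => ?_
  rw [ENNReal.mul_rpow_of_nonneg _ _ (add_nonneg hq zero_le_one), ENNReal.mul_rpow_of_nonneg _ _ hq,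
    poissonWeight_rpow_add_one _ (ν.real Set.univ) hq, mul_mul_mul_comm]
  gcongr
  exact pi_withDensity_rpow_add_one_le ν hg hq (measurable_ofPoints n hD)

theorem IsPoissonLaw.real_rpow_add_one_le_of_withDensity {P Q : Measure (Configuration X)}
    (hP : IsPoissonLaw P (ν.withDensity g)) (hQ : IsPoissonLaw Q ν) (hg : Measurable g)
    (hq : 0 ≤ q) (hgq : ∫⁻ x, g x ^ (q + 1) ∂ν ≠ ∞) {D : Set (Configuration X)}
    (hD : MeasurableSet D) :
    P.real D ^ (q + 1) ≤
      Real.exp ((∫⁻ x, g x ^ (q + 1) ∂ν).toReal -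
        ((q + 1) * (ν.withDensity g).real Set.univ - q * ν.real Set.univ)) * Q.real D ^ q := by
  rw [hP.eq_finitePoisson, hQ.eq_finitePoisson]
  have h := ENNReal.toReal_mono (ENNReal.mul_ne_top ENNReal.ofReal_ne_top
    (ENNReal.rpow_ne_top_of_nonneg hq (measure_ne_top _ _)))
    (finitePoisson_withDensity_rpow_add_one_le hg hq hgq hD)
  rwa [ENNReal.toReal_mul, ← ENNReal.toReal_rpow, ← ENNReal.toReal_rpow,
    ENNReal.toReal_ofReal (Real.exp_pos _).le] at h

end

/-! ### Local sets of configurations -/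

section

variable {X : Type*} [MeasurableSpace X] {B : ℕ → Set X} {hB : ∀ n, MeasurableSet (B n)}

/-- The sets of configurations that depend on the restriction to some `B n` only. -/
def localSets (B : ℕ → Set X) (hB : ∀ n, MeasurableSet (B n)) : Set (Set (Configuration X)) :=
  {D | ∃ n, ∃ D', MeasurableSet D' ∧ D = Configuration.restrict (B n) (hB n) ⁻¹' D'}

theorem eventually_exists_eq_restrict_preimage (hmono : Monotone B) {D : Set (Configuration X)}
    (hD : D ∈ localSets B hB) : ∀ᶠ n in atTop, ∃ D', MeasurableSet D' ∧
      D = Configuration.restrict (B n) (hB n) ⁻¹' D' := by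
  obtain ⟨m, D', hD', rfl⟩ := hD
  filter_upwards [eventually_ge_atTop m] with n hn
  refine ⟨_, Configuration.measurable_restrict (hB m) hD', ?_⟩
  ext ω
  simp only [Set.mem_preimage, Configuration.restrict_restrict (hB m) (hB n) (hmono hn)]

theorem isSetAlgebra_localSets (hmono : Monotone B) : IsSetAlgebra (localSets B hB) where
  empty_mem := ⟨0, ∅, MeasurableSet.empty, rfl⟩
  compl_mem := by
    rintro _ ⟨n, D', hD', rfl⟩
    exact ⟨n, D'ᶜ, hD'.compl, rfl⟩
  union_mem := by
    intro D E hD hE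
    obtain ⟨n, ⟨D', hD', rfl⟩, E', hE', rfl⟩ :=
      ((eventually_exists_eq_restrict_preimage hmono hD).and
        (eventually_exists_eq_restrict_preimage hmono hE)).exists
    exact ⟨n, D' ∪ E', hD'.union hE', rfl⟩

theorem generateFrom_localSets (hmono : Monotone B) (hU : ⋃ n, B n = Set.univ) :
    (inferInstance : MeasurableSpace (Configuration X)) =
      MeasurableSpace.generateFrom (localSets B hB) := by
  refine le_antisymm ?_ (MeasurableSpace.generateFrom_le ?_)
  · refine Measurable.comap_le (Measure.measurable_of_measurable_coe _ fun A hA => ?_)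
    have hsup : (fun ω : Configuration X => ω.1 A) =
        fun ω => ⨆ n, (Configuration.restrict (B n) (hB n) ω).1 A := by
      funext ω
      have hAB : A = ⋃ n, A ∩ B n := by rw [← Set.inter_iUnion, hU, Set.inter_univ]
      conv_lhs => rw [hAB]
      rw [Monotone.measure_iUnion fun m n hmn => Set.inter_subset_inter_right A (hmono hmn)]
      exact iSup_congr fun n => (Measure.restrict_apply hA).symm
    rw [hsup]
    exact Measurable.iSup fun n S hS => MeasurableSpace.measurableSet_generateFrom
      ⟨n, _, Configuration.measurable_apply hA hS, rfl⟩
  · rintro _ ⟨n, D', hD', rfl⟩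
    exact Configuration.measurable_restrict (hB n) hD'

end

theorem mem_of_forall_isSetAlgebra_mem {Y : Type*} [m : MeasurableSpace Y] {P Q : Measure Y}
    [IsFiniteMeasure P] [IsFiniteMeasure Q] {𝒜 : Set (Set Y)} (h𝒜 : IsSetAlgebra 𝒜)
    (hgen : m = MeasurableSpace.generateFrom 𝒜) {F : Set (ℝ × ℝ)} (hF : IsClosed F)
    (h : ∀ D ∈ 𝒜, (P.real D, Q.real D) ∈ F) {D : Set Y} (hD : MeasurableSet D) :
    (P.real D, Q.real D) ∈ F := by
  have hdense := Measure.MeasureDense.of_generateFrom_isSetAlgebra_finite (P + Q) h𝒜 hgen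
  have hε (n : ℕ) : (0 : ℝ) < 1 / ((n : ℝ) + 1) := Nat.one_div_pos_of_nat
  choose t ht htD using fun n : ℕ => hdense.approx D hD (measure_ne_top _ _) _ (hε n)
  have hlim (R : Measure Y) [IsFiniteMeasure R] (hR : R ≤ P + Q) :
      Tendsto (fun n => R.real (t n)) atTop (𝓝 (R.real D)) := by
    rw [tendsto_iff_dist_tendsto_zero]
    refine squeeze_zero (fun n => dist_nonneg) (fun n => ?_) tendsto_one_div_add_atTop_nhds_zero_nat
    rw [dist_comm, Real.dist_eq]
    refine (abs_measureReal_sub_le_measureReal_symmDiff hD.nullMeasurableSet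
      (hdense.measurable _ (ht n)).nullMeasurableSet).trans ?_
    exact ENNReal.toReal_le_of_le_ofReal (hε n).le ((hR _).trans (htD n).le)
  exact hF.mem_of_tendsto ((hlim P (Measure.le_add_right le_rfl)).prodMk_nhds
    (hlim Q (Measure.le_add_left le_rfl))) (Eventually.of_forall fun n => h _ (ht n))

/-! ### Comparison of two Poisson laws of equivalent intensities -/

section Comparison

variable {X : Type*} [MeasurableSpace X] {μ ν : Measure X} {s : Set X}

theorem integrableOn_of_integrable_sub_one {f : X → ℝ} (hf : Integrable (fun x => f x - 1) μ)
    (hμs : μ s ≠ ∞) : IntegrableOn f s μ :=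
  (hf.integrableOn.add (integrableOn_const hμs)).congr
    (Eventually.of_forall fun x => sub_add_cancel (f x) 1)

theorem setIntegral_sub_one {f : X → ℝ} (hf : IntegrableOn f s μ) (hμs : μ s ≠ ∞) :
    ∫ x in s, (f x - 1) ∂μ = ∫ x in s, f x ∂μ - μ.real s := by
  rw [integral_sub hf (integrableOn_const hμs), setIntegral_const, smul_eq_mul, mul_one]

theorem tendsto_setIntegral_spanningSets [SigmaFinite μ] {f : X → ℝ} (hf : Integrable f μ) :
    Tendsto (fun n => ∫ x in spanningSets μ n, f x ∂μ) atTop (𝓝 (∫ x, f x ∂μ)) := by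
  have h := tendsto_setIntegral_of_monotone (measurableSet_spanningSets μ)
    (monotone_spanningSets μ) (f := f) hf.integrableOn
  rwa [iUnion_spanningSets, setIntegral_univ] at h

variable [SigmaFinite μ] [SigmaFinite ν]

theorem measure_ne_top_of_integrableOn_rnDeriv (hνμ : ν ≪ μ)
    (h : IntegrableOn (fun x => (ν.rnDeriv μ x).toReal) s μ) : ν s ≠ ∞ := by
  rw [← Measure.setLIntegral_rnDeriv hνμ, ← lintegral_congr_ae (ae_restrict_of_ae
    ((Measure.rnDeriv_lt_top ν μ).mono fun x hx => ENNReal.ofReal_toReal hx.ne))]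
  exact h.lintegral_lt_top.ne

theorem setLIntegral_rnDeriv_rpow_add_one (hμν : μ ≪ ν) {q : ℝ} (hq : 0 ≤ q)
    (hs : MeasurableSet s)
    (h : IntegrableOn (fun x => (μ.rnDeriv ν x).toReal ^ q) s μ) :
    ∫⁻ x in s, μ.rnDeriv ν x ^ (q + 1) ∂ν =
      ENNReal.ofReal (∫ x in s, (μ.rnDeriv ν x).toReal ^ q ∂μ) := by
  have hlt : ∀ᵐ x ∂μ.restrict s, μ.rnDeriv ν x < ∞ :=
    ae_restrict_of_ae (hμν.ae_le (Measure.rnDeriv_lt_top μ ν))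
  calc ∫⁻ x in s, μ.rnDeriv ν x ^ (q + 1) ∂ν
      = ∫⁻ x in s, μ.rnDeriv ν x * μ.rnDeriv ν x ^ q ∂ν := by
        refine lintegral_congr fun x => ?_
        rw [ENNReal.rpow_add_of_nonneg _ _ hq zero_le_one, ENNReal.rpow_one, mul_comm]
    _ = ∫⁻ x in s, μ.rnDeriv ν x ^ q ∂μ :=
        setLIntegral_rnDeriv_mul hμν
          ((Measure.measurable_rnDeriv μ ν).pow_const q).aemeasurable hs
    _ = ∫⁻ x in s, ENNReal.ofReal ((μ.rnDeriv ν x).toReal ^ q) ∂μ := by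
        refine lintegral_congr_ae (hlt.mono fun x hx => ?_)
        beta_reduce
        rw [← ENNReal.ofReal_rpow_of_nonneg ENNReal.toReal_nonneg hq, ENNReal.ofReal_toReal hx.ne]
    _ = _ := (ofReal_integral_eq_lintegral_ofReal h
        (Eventually.of_forall fun x => by positivity)).symm

namespace IsPoissonLaw

variable {P Q : Measure (Configuration X)} (hP : IsPoissonLaw P μ) (hQ : IsPoissonLaw Q ν)
  (hμν : μ ≪ ν) (hνμ : ν ≪ μ) {q : ℝ} (hq : 0 ≤ q)
  (hf : Integrable (fun x => (ν.rnDeriv μ x).toReal - 1) μ)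
  (hg : Integrable (fun x => (μ.rnDeriv ν x).toReal ^ q - 1) μ)

include hP hQ hμν hνμ hq hf hg

theorem real_restrict_preimage_rpow_add_one_le (hs : MeasurableSet s) (hμs : μ s ≠ ∞)
    {D : Set (Configuration X)} (hD : MeasurableSet D) :
    P.real (Configuration.restrict s hs ⁻¹' D) ^ (q + 1) ≤
      Real.exp (q * ∫ x in s, ((ν.rnDeriv μ x).toReal - 1) ∂μ +
        ∫ x in s, ((μ.rnDeriv ν x).toReal ^ q - 1) ∂μ) *
      Q.real (Configuration.restrict s hs ⁻¹' D) ^ q := by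
  have hfs := integrableOn_of_integrable_sub_one hf hμs
  have hgs := integrableOn_of_integrable_sub_one hg hμs
  have hνs := measure_ne_top_of_integrableOn_rnDeriv hνμ hfs
  have : IsFiniteMeasure (μ.restrict s) := ⟨by simpa using hμs.lt_top⟩
  have : IsFiniteMeasure (ν.restrict s) := ⟨by simpa using hνs.lt_top⟩
  have hdens : (ν.restrict s).withDensity (μ.rnDeriv ν) = μ.restrict s := by
    rw [← restrict_withDensity hs, Measure.withDensity_rnDeriv_eq _ _ hμν]
  have : IsFiniteMeasure ((ν.restrict s).withDensity (μ.rnDeriv ν)) := by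
    rw [hdens]
    infer_instance
  have hmoment := setLIntegral_rnDeriv_rpow_add_one hμν hq hs hgs
  have h := IsPoissonLaw.real_rpow_add_one_le_of_withDensity (hdens ▸ hP.restrict hs)
    (hQ.restrict hs) (Measure.measurable_rnDeriv μ ν) hq
    (hmoment.trans_ne ENNReal.ofReal_ne_top) hD
  rw [hmoment, hdens, ENNReal.toReal_ofReal (integral_nonneg fun x => by positivity),
    measureReal_restrict_apply_univ, measureReal_restrict_apply_univ,
    map_measureReal_apply (Configuration.measurable_restrict hs) hD,
    map_measureReal_apply (Configuration.measurable_restrict hs) hD] at h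
  convert h using 3
  rw [setIntegral_sub_one hfs hμs, setIntegral_sub_one hgs hμs,
    Measure.setIntegral_toReal_rnDeriv hνμ]
  ring

theorem real_rpow_add_one_le {D : Set (Configuration X)} (hD : MeasurableSet D) :
    P.real D ^ (q + 1) ≤
      Real.exp (q * ∫ x, ((ν.rnDeriv μ x).toReal - 1) ∂μ +
        ∫ x, ((μ.rnDeriv ν x).toReal ^ q - 1) ∂μ) * Q.real D ^ q := by
  have := hP.isProbabilityMeasure
  have := hQ.isProbabilityMeasure
  have hmono := monotone_spanningSets μ
  have hlim := (Real.continuous_exp.tendsto _).comp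
    (((tendsto_setIntegral_spanningSets hf).const_mul q).add (tendsto_setIntegral_spanningSets hg))
  have hclosed : IsClosed {p : ℝ × ℝ | p.1 ^ (q + 1) ≤
      Real.exp (q * ∫ x, ((ν.rnDeriv μ x).toReal - 1) ∂μ +
        ∫ x, ((μ.rnDeriv ν x).toReal ^ q - 1) ∂μ) * p.2 ^ q} :=
    isClosed_le (continuous_fst.rpow_const fun _ => Or.inr (by positivity))
      (continuous_const.mul (continuous_snd.rpow_const fun _ => Or.inr hq))
  refine mem_of_forall_isSetAlgebra_mem (isSetAlgebra_localSets hmono)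
    (generateFrom_localSets (hB := measurableSet_spanningSets μ) hmono (iUnion_spanningSets μ))
    hclosed (fun D hD => ge_of_tendsto (hlim.mul_const _) ?_) hD
  filter_upwards [eventually_exists_eq_restrict_preimage hmono hD] with n hn
  obtain ⟨D', hD', rfl⟩ := hn
  exact hP.real_restrict_preimage_rpow_add_one_le hQ hμν hνμ hq hf hg _
    (measure_spanningSets_lt_top μ n).ne hD'

end IsPoissonLaw

end Comparison

theorem absolutelyContinuous_of_real_rpow_add_one_le {Y : Type*} [MeasurableSpace Y]
    {P Q : Measure Y} [IsFiniteMeasure P] {q c : ℝ} (hq : 0 < q)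
    (h : ∀ D, MeasurableSet D → P.real D ^ (q + 1) ≤ c * Q.real D ^ q) : P ≪ Q := by
  refine Measure.AbsolutelyContinuous.mk fun D hD hQD => ?_
  have hle : P.real D ^ (q + 1) ≤ 0 := by
    simpa [measureReal_def Q, hQD, Real.zero_rpow hq.ne'] using h D hD
  have hzero : P.real D ^ (q + 1) = 0 := hle.antisymm (by positivity)
  exact (measureReal_eq_zero_iff).1
    ((Real.rpow_eq_zero measureReal_nonneg (by positivity)).1 hzero)

/-! ### Representatives of elements of `Aut(X, μ)` -/

namespace Aut

variable {X : Type*} [MeasurableSpace X] {μ : Measure X}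

theorem quasiMeasurePreserving_rep (T : Aut μ) : Measure.QuasiMeasurePreserving T.rep μ μ :=
  (Quotient.out T : nonsingularPerm μ).2.1

theorem quasiMeasurePreserving_rep_symm (T : Aut μ) :
    Measure.QuasiMeasurePreserving T.rep.symm μ μ :=
  (Quotient.out T : nonsingularPerm μ).2.2

theorem measurable_rep_symm (T : Aut μ) : Measurable T.rep.symm :=
  T.quasiMeasurePreserving_rep_symm.measurable

theorem measure_eq_zero_of_preimage_rep (T : Aut μ) {A : Set X} (hA : μ (T.rep ⁻¹' A) = 0) :
    μ A = 0 := by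
  have h := T.quasiMeasurePreserving_rep_symm.preimage_null hA
  rwa [← Set.preimage_comp, Equiv.self_comp_symm, Set.preimage_id] at h

theorem mk_eq_mk_iff {S T : nonsingularPerm μ} :
    (QuotientGroup.mk S : Aut μ) = QuotientGroup.mk T ↔
      ∀ᵐ x ∂μ, (S : Equiv.Perm X) x = (T : Equiv.Perm X) x := by
  rw [QuotientGroup.eq]
  change (∀ᵐ x ∂μ, (S : Equiv.Perm X).symm ((T : Equiv.Perm X) x) = x) ↔ _
  refine eventually_congr (Eventually.of_forall fun x => ?_)
  rw [Equiv.symm_apply_eq, eq_comm]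

theorem rep_mk (S : nonsingularPerm μ) :
    ∀ᵐ x ∂μ, rep (QuotientGroup.mk S : Aut μ) x = (S : Equiv.Perm X) x :=
  mk_eq_mk_iff.1 (Quotient.out_eq (QuotientGroup.mk S : Aut μ))

theorem rep_mul (S T : Aut μ) : ∀ᵐ x ∂μ, (S * T).rep x = S.rep (T.rep x) := by
  have h : S * T = (QuotientGroup.mk (Quotient.out S * Quotient.out T) : Aut μ) := by
    conv_lhs => rw [← Quotient.out_eq S, ← Quotient.out_eq T]
    rfl
  rw [h]
  exact rep_mk _

theorem rep_inv (T : Aut μ) : ∀ᵐ x ∂μ, T⁻¹.rep x = T.rep.symm x := by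
  have h : T⁻¹ = (QuotientGroup.mk (Quotient.out T)⁻¹ : Aut μ) := by
    conv_lhs => rw [← Quotient.out_eq T]
    rfl
  rw [h]
  exact rep_mk _

theorem rep_symm_inv (T : Aut μ) : ∀ᵐ x ∂μ, T⁻¹.rep.symm x = T.rep x := by
  filter_upwards [T.quasiMeasurePreserving_rep.ae T.rep_inv] with x hx
  rw [Equiv.symm_apply_eq, hx, Equiv.symm_apply_apply]

theorem rep_one : ∀ᵐ x ∂μ, (1 : Aut μ).rep x = x := rep_mk (1 : nonsingularPerm μ)

theorem eq_one_of_ae {T : Aut μ} (h : ∀ᵐ x ∂μ, T.rep x = x) : T = 1 := by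
  rw [← Quotient.out_eq T]
  exact mk_eq_mk_iff.2 h

theorem compAut_absolutelyContinuous (T : Aut μ) : compAut μ T ≪ μ :=
  T.quasiMeasurePreserving_rep_symm.absolutelyContinuous

theorem absolutelyContinuous_compAut (T : Aut μ) : μ ≪ compAut μ T := by
  refine Measure.AbsolutelyContinuous.mk fun s hs h => ?_
  rw [compAut, Measure.map_apply T.measurable_rep_symm hs] at h
  have := T.quasiMeasurePreserving_rep.preimage_null h
  rwa [← Set.preimage_comp, Equiv.symm_comp_self, Set.preimage_id] at this

theorem sigmaFinite_compAut [SigmaFinite μ] (T : Aut μ) : SigmaFinite (compAut μ T) :=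
  let e : X ≃ᵐ X := ⟨T.rep, T.measurable_rep, T.measurable_rep_symm⟩
  e.symm.sigmaFinite_map

end Aut

/-! ### Poisson suspensions -/

namespace Configuration

variable {X : Type*} [MeasurableSpace X] {S T : X → X}

theorem map_map (hS : Measurable S) (hT : Measurable T) (ω : Configuration X) :
    map S hS (map T hT ω) = map (S ∘ T) (hS.comp hT) ω :=
  Subtype.ext (Measure.map_map hS hT)

theorem map_id (ω : Configuration X) : map id measurable_id ω = ω := Subtype.ext Measure.map_id

theorem ae_map_congr {P : Measure (Configuration X)} {μ : Measure X} (hP : IsPoissonLaw P μ)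
    (hS : Measurable S) (hT : Measurable T) (hST : ∀ᵐ x ∂μ, S x = T x) :
    ∀ᵐ ω ∂P, map S hS ω = map T hT ω := by
  filter_upwards [hP.ae_apply_eq_zero hST] with ω hω
  exact Subtype.ext (Measure.map_congr hω)

end Configuration

section Suspension

variable {X : Type*} [MeasurableSpace X] {μ : Measure X}

/-- The permutation `ω ↦ ω ∘ T⁻¹` of the space of configurations. -/
def suspensionPerm (T : Aut μ) : Equiv.Perm (Configuration X) where
  toFun := Configuration.map T.rep T.measurable_rep
  invFun := Configuration.map T.rep.symm T.measurable_rep_symm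
  left_inv ω := by
    simp_rw [Configuration.map_map, Equiv.symm_comp_self]
    exact Configuration.map_id ω
  right_inv ω := by
    simp_rw [Configuration.map_map, Equiv.self_comp_symm]
    exact Configuration.map_id ω

theorem measurable_suspensionPerm (T : Aut μ) : Measurable (suspensionPerm T) :=
  Configuration.measurable_map T.measurable_rep

theorem measurable_suspensionPerm_symm (T : Aut μ) : Measurable (suspensionPerm T).symm :=
  Configuration.measurable_map T.measurable_rep_symm

theorem suspensionPerm_mul_ae [SFinite μ] (S T : Aut μ) :
    suspensionPerm (S * T) =ᵐ[poisson μ] suspensionPerm S ∘ suspensionPerm T := by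
  filter_upwards [Configuration.ae_map_congr (isPoissonLaw_poisson μ) (S * T).measurable_rep
    (S.measurable_rep.comp T.measurable_rep) (S.rep_mul T)] with ω hω
  exact hω.trans (Configuration.map_map S.measurable_rep T.measurable_rep ω).symm

theorem suspensionPerm_symm_inv_ae [SFinite μ] (T : Aut μ) :
    (suspensionPerm T⁻¹).symm =ᵐ[poisson μ] suspensionPerm T :=
  Configuration.ae_map_congr (isPoissonLaw_poisson μ) T⁻¹.measurable_rep_symm T.measurable_rep
    T.rep_symm_inv

theorem suspensionPerm_mem_nonsingularPerm [SFinite μ] (T : Aut μ)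
    (hT : poisson μ ≪ (poisson μ).map (suspensionPerm T).symm)
    (hT' : poisson μ ≪ (poisson μ).map (suspensionPerm T⁻¹).symm) :
    suspensionPerm T ∈ nonsingularPerm (poisson μ) := by
  refine ⟨⟨measurable_suspensionPerm T, ?_⟩, ⟨measurable_suspensionPerm_symm T, ?_⟩⟩
  · have h := hT.map (measurable_suspensionPerm T)
    rwa [Measure.map_map (measurable_suspensionPerm T) (measurable_suspensionPerm_symm T),
      Equiv.self_comp_symm, Measure.map_id] at h
  · rw [Measure.map_congr (suspensionPerm_symm_inv_ae T)] at hT'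
    have h := hT'.map (measurable_suspensionPerm_symm T)
    rwa [Measure.map_map (measurable_suspensionPerm_symm T) (measurable_suspensionPerm T),
      Equiv.symm_comp_self, Measure.map_id] at h

/-- The homomorphism `γ ↦ γ_*` on a group of transformations whose suspensions are nonsingular. -/
def suspensionHom [SFinite μ] (Γ : Subgroup (Aut μ))
    (hΓ : ∀ γ ∈ Γ, suspensionPerm γ ∈ nonsingularPerm (poisson μ)) : Γ →* Aut (poisson μ) :=
  MonoidHom.mk' (fun γ => QuotientGroup.mk ⟨suspensionPerm γ.1, hΓ γ.1 γ.2⟩) fun γ δ => by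
    rw [← QuotientGroup.mk_mul, Aut.mk_eq_mk_iff]
    exact suspensionPerm_mul_ae γ.1 δ.1

theorem isSuspension_suspensionHom [SFinite μ] {Γ : Subgroup (Aut μ)}
    (hΓ : ∀ γ ∈ Γ, suspensionPerm γ ∈ nonsingularPerm (poisson μ)) (γ : Γ) :
    IsSuspension γ.1 (suspensionHom Γ hΓ γ) :=
  Aut.rep_mk _

theorem poisson_real_rpow_add_one_le [SigmaFinite μ] {T : Aut μ} (hT : T ∈ Aut₁ μ) {q : ℝ}
    (hq : 0 ≤ q) (hint : Integrable (fun x => (μ.rnDeriv (compAut μ T) x).toReal ^ q - 1) μ)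
    {D : Set (Configuration X)} (hD : MeasurableSet D) :
    (poisson μ).real D ^ (q + 1) ≤
      Real.exp (q * χ μ T + ∫ x, ((μ.rnDeriv (compAut μ T) x).toReal ^ q - 1) ∂μ) *
        ((poisson μ).map (suspensionPerm T).symm).real D ^ q :=
  have : SigmaFinite (μ.map T.rep.symm) := T.sigmaFinite_compAut
  (isPoissonLaw_poisson μ).real_rpow_add_one_le
    ((isPoissonLaw_poisson μ).map T.measurable_rep_symm) T.absolutelyContinuous_compAut
    T.compAut_absolutelyContinuous hq hT hint hD

end Suspension

/-! ### Injectivity of the suspension -/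

section Injectivity

variable {X : Type*} [MeasurableSpace X] {μ : Measure X}

theorem ae_eq_self_of_forall_disjoint_preimage [MeasurableSpace.CountablySeparated X] {T : X → X}
    (hT : Measurable T)
    (h : ∀ A, MeasurableSet A → Disjoint A (T ⁻¹' A) → μ A = 0) : ∀ᵐ x ∂μ, T x = x := by
  have hstay {S : Set X} (hS : MeasurableSet S) : ∀ᵐ x ∂μ, x ∈ S → T x ∈ S := by
    have hnull : μ (S ∩ T ⁻¹' Sᶜ) = 0 :=
      h _ (hS.inter (hT hS.compl)) (Set.disjoint_left.2 fun x hx hx' => hx.2 hx'.1)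
    filter_upwards [measure_eq_zero_iff_ae_notMem.1 hnull] with x hx hxS
    exact of_not_not fun hTx => hx ⟨hxS, hTx⟩
  obtain ⟨S, hS, hsep⟩ := exists_seq_separating X (p := MeasurableSet) MeasurableSet.empty
    Set.univ
  filter_upwards [ae_all_iff.2 fun n => hstay (hS n), ae_all_iff.2 fun n => hstay (hS n).compl]
    with x hx hx'
  exact hsep _ trivial _ trivial fun n => ⟨fun hTx => of_not_not fun hxS => hx' n hxS hTx, hx n⟩

theorem ae_eq_self_of_forall_disjoint_preimage_of_ne_top
    [MeasurableSpace.CountablySeparated X] [SigmaFinite μ] {T : X → X} (hT : Measurable T)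
    (h : ∀ A, MeasurableSet A → μ A ≠ ∞ → Disjoint A (T ⁻¹' A) → μ A = 0) :
    ∀ᵐ x ∂μ, T x = x := by
  refine ae_eq_self_of_forall_disjoint_preimage hT fun A hA hdisj => ?_
  rw [← Set.inter_univ A, ← iUnion_spanningSets μ, Set.inter_iUnion]
  exact measure_iUnion_null fun n => h _ (hA.inter (measurableSet_spanningSets μ n))
    ((measure_mono Set.inter_subset_right).trans_lt (measure_spanningSets_lt_top μ n)).ne
    (hdisj.mono Set.inter_subset_left (Set.preimage_mono Set.inter_subset_left))

/-- By the void probabilities, `μ A = μ (A ∪ A')` when `A` and `A'` are void simultaneously. -/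
theorem IsPoissonLaw.measure_eq_zero_of_ae_apply_eq {P : Measure (Configuration X)}
    (hP : IsPoissonLaw P μ) {A A' : Set X} (hA : MeasurableSet A) (hA' : MeasurableSet A')
    (hdisj : Disjoint A A') (htop : μ A ≠ ∞) (h : ∀ᵐ ω ∂P, ω.1 A = ω.1 A') : μ A' = 0 := by
  have hvoid : ({ω | ω.1 A = 0} : Set (Configuration X)) =ᵐ[P] {ω | ω.1 (A ∪ A') = 0} := by
    filter_upwards [h] with ω hω
    refine propext ?_
    change ω.1 A = 0 ↔ ω.1 (A ∪ A') = 0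
    rw [measure_union_null_iff, ← hω, and_self]
  have heq : μ A = μ A + μ A' := expNeg_strictAnti.injective <| by
    rw [← hP.measure_apply_eq_zero hA, ← measure_union hdisj hA',
      ← hP.measure_apply_eq_zero (hA.union hA'), measure_congr hvoid]
  exact (ENNReal.add_right_inj htop).1 (by rw [add_zero, ← heq])

variable [MeasurableSpace.CountablySeparated X] [SigmaFinite μ]

theorem eq_one_of_isSuspension_one {T : Aut μ} (hT : IsSuspension T (1 : Aut (poisson μ))) :
    T = 1 := by
  refine Aut.eq_one_of_ae
    (ae_eq_self_of_forall_disjoint_preimage_of_ne_top T.measurable_rep fun A hA htop hdisj =>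
      T.measure_eq_zero_of_preimage_rep ?_)
  refine (isPoissonLaw_poisson μ).measure_eq_zero_of_ae_apply_eq hA (T.measurable_rep hA) hdisj
    htop ?_
  filter_upwards [hT, Aut.rep_one (μ := poisson μ)] with ω hω hone
  conv_lhs => rw [← hone, hω]
  exact Measure.map_apply T.measurable_rep hA

theorem suspensionHom_injective {Γ : Subgroup (Aut μ)}
    (hΓ : ∀ γ ∈ Γ, suspensionPerm γ ∈ nonsingularPerm (poisson μ)) :
    Function.Injective (suspensionHom Γ hΓ) := by
  refine (injective_iff_map_eq_one _).2 fun γ hγ => Subtype.ext (eq_one_of_isSuspension_one ?_)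
  exact hγ ▸ isSuspension_suspensionHom hΓ γ

end Injectivity

/-! ### Conservativity -/

section Conservativity

variable {Y : Type*} [MeasurableSpace Y] {P : Measure Y} (H : Subgroup (Aut P)) {B : Set Y}

/-- The number of elements of `H` that map `y` into `B`. -/
def visits (B : Set Y) (y : Y) : ℝ≥0∞ := ∑' h : H, B.indicator 1 (h.1.rep y)

theorem visits_eq_encard (B : Set Y) (y : Y) :
    visits H B y = ({γ : Aut P | γ ∈ H ∧ γ.rep y ∈ B}.encard : ℝ≥0∞) := by
  have himage : {γ : Aut P | γ ∈ H ∧ γ.rep y ∈ B} = Subtype.val '' {h : H | h.1.rep y ∈ B} := by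
    ext γ
    simp [and_comm]
  rw [himage, Subtype.val_injective.encard_image, ← ENNReal.tsum_set_one,
    tsum_subtype {h : H | h.1.rep y ∈ B} fun _ => (1 : ℝ≥0∞)]
  rfl

theorem visits_mono {C : Set Y} (hCB : C ⊆ B) (y : Y) : visits H C y ≤ visits H B y :=
  ENNReal.tsum_le_tsum fun _ =>
    Set.indicator_le_indicator_of_subset hCB (fun _ => zero_le) _

variable [Countable H]

theorem measurable_visits (hB : MeasurableSet B) : Measurable (visits H B) :=
  Measurable.tsum fun h => (measurable_one.indicator hB).comp h.1.measurable_rep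

theorem lintegral_visits (hB : MeasurableSet B) :
    ∫⁻ y, visits H B y ∂P = ∑' h : H, P (h.1.rep ⁻¹' B) := by
  have hmeas (h : H) : AEMeasurable (fun y => B.indicator (1 : Y → ℝ≥0∞) (h.1.rep y)) P :=
    ((measurable_one.indicator hB).comp h.1.measurable_rep).aemeasurable
  simp only [visits]
  rw [lintegral_tsum hmeas]
  refine tsum_congr fun h => ?_
  rw [← lintegral_indicator_one (h.1.measurable_rep hB)]
  rfl

theorem ae_visits_rep_eq (B : Set Y) :
    ∀ᵐ y ∂P, ∀ h : H, visits H B (h.1.rep y) = visits H B y := by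
  filter_upwards [ae_all_iff.2 fun g : H => ae_all_iff.2 fun h : H => g.1.rep_mul h.1] with y hy h
  calc visits H B (h.1.rep y) = ∑' g : H, B.indicator 1 ((g * h).1.rep y) :=
        tsum_congr fun g => congrArg (B.indicator 1) (hy g h).symm
    _ = visits H B y :=
        (Equiv.mulRight h).tsum_eq fun g : H => B.indicator (1 : Y → ℝ≥0∞) (g.1.rep y)

theorem ae_visits_sep_le (B : Set Y) (m : ℝ≥0∞) :
    ∀ᵐ y ∂P, visits H {z | z ∈ B ∧ visits H B z ≤ m} y ≤ m := by
  filter_upwards [ae_visits_rep_eq H B] with y hy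
  by_cases hvisit : ∃ h : H, h.1.rep y ∈ {z | z ∈ B ∧ visits H B z ≤ m}
  · obtain ⟨h, -, hle⟩ := hvisit
    exact (visits_mono H (fun z hz => hz.1) y).trans ((hy h).symm.trans_le hle)
  · push Not at hvisit
    rw [visits, ENNReal.tsum_eq_zero.2 fun h => Set.indicator_of_notMem (hvisit h) _]
    exact zero_le

theorem isConservative_of_tsum_eq_top [IsFiniteMeasure P]
    (hH : ∀ C : Set Y, MeasurableSet C → P C ≠ 0 → ∑' h : H, P (h.1.rep ⁻¹' C) = ∞) :
    IsConservative H := by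
  intro B hB _
  have hnull (m : ℕ) : P {y | y ∈ B ∧ visits H B y ≤ m} = 0 := by
    have hmeas : MeasurableSet {y | y ∈ B ∧ visits H B y ≤ m} :=
      hB.inter (measurableSet_le (measurable_visits H hB) measurable_const)
    by_contra hne
    refine (hH _ hmeas hne).not_lt ?_
    calc ∑' h : H, P (h.1.rep ⁻¹' {y | y ∈ B ∧ visits H B y ≤ m})
        = ∫⁻ y, visits H {y | y ∈ B ∧ visits H B y ≤ m} y ∂P := (lintegral_visits H hmeas).symm
      _ ≤ ∫⁻ _, m ∂P := lintegral_mono_ae (ae_visits_sep_le H B m)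
      _ < ∞ := by
        rw [lintegral_const]
        exact ENNReal.mul_lt_top (ENNReal.natCast_lt_top m) (measure_lt_top P _)
  filter_upwards [ae_all_iff.2 fun m => measure_eq_zero_iff_ae_notMem.1 (hnull m)]
    with y hy hyB hfin
  refine hy {γ : Aut P | γ ∈ H ∧ γ.rep y ∈ B}.ncard ⟨hyB, ?_⟩
  rw [visits_eq_encard, ← hfin.cast_ncard_eq]
  exact le_rfl

end Conservativity

theorem isConservative_range_suspensionHom {X : Type*} [MeasurableSpace X]
    [MeasurableSpace.CountablySeparated X] {μ : Measure X} [SigmaFinite μ] {Γ : Subgroup (Aut μ)}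
    [Countable Γ] (hΓ : ∀ γ ∈ Γ, suspensionPerm γ ∈ nonsingularPerm (poisson μ))
    (hsum : ∀ D : Set (Configuration X), MeasurableSet D → poisson μ D ≠ 0 →
      ∑' γ : Γ, (poisson μ).map (suspensionPerm γ.1).symm D = ∞) :
    IsConservative (suspensionHom Γ hΓ).range := by
  have hcount : Countable (suspensionHom Γ hΓ).range :=
    (suspensionHom Γ hΓ).rangeRestrict_surjective.countable
  refine isConservative_of_tsum_eq_top _ fun D hD hD0 => ?_
  rw [← hsum D hD hD0, ← (MonoidHom.ofInjective (suspensionHom_injective hΓ)).toEquiv.tsum_eq,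
    ← (Equiv.inv Γ).tsum_eq fun γ : Γ => (poisson μ).map (suspensionPerm γ.1).symm D]
  refine tsum_congr fun γ => ?_
  have hsusp : (suspensionHom Γ hΓ γ).rep =ᵐ[poisson μ] suspensionPerm γ.1 :=
    isSuspension_suspensionHom hΓ γ
  have hrep : (suspensionHom Γ hΓ γ).rep =ᵐ[poisson μ] (suspensionPerm γ⁻¹.1).symm :=
    hsusp.trans (suspensionPerm_symm_inv_ae γ.1).symm
  exact (measure_congr (hrep.preimage D)).trans
    (Measure.map_apply (measurable_suspensionPerm_symm _) hD).symm

theorem tsum_measure_eq_top_of_rpow_add_one_le {Y ι : Type*} [MeasurableSpace Y] {P : Measure Y}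
    [IsFiniteMeasure P] {Q : ι → Measure Y} {q : ℝ} (hq : 0 < q)
    {b e : ι → ℝ} (hb : ∀ i, 0 ≤ b i) (hbsum : ¬ Summable b)
    (hbe : Summable fun i => b i ^ q * e i) {D : Set Y} (hD : P D ≠ 0)
    (h : ∀ i, P.real D ^ (q + 1) ≤ e i * (Q i).real D ^ q) : ∑' i, Q i D = ∞ := by
  by_contra hne
  have hQ : Summable fun i => (Q i).real D := ENNReal.summable_toReal hne
  have hpos : 0 < P.real D := ENNReal.toReal_pos hD (measure_ne_top _ _)
  have hev : ∀ᶠ i in cofinite, b i ^ q * e i ≤ 1 :=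
    hbe.tendsto_cofinite_zero.eventually_le_const one_pos
  refine hbsum ((hQ.mul_left (P.real D ^ ((q + 1) / q))⁻¹).of_norm_bounded_eventually ?_)
  filter_upwards [hev] with i hi
  have hbi := hb i
  rw [Real.norm_of_nonneg hbi, inv_mul_eq_div, le_div_iff₀ (by positivity)]
  refine (Real.rpow_le_rpow_iff (by positivity) measureReal_nonneg hq).1 ?_
  calc (b i * P.real D ^ ((q + 1) / q)) ^ q = b i ^ q * P.real D ^ (q + 1) := by
        rw [Real.mul_rpow hbi (by positivity), ← Real.rpow_mul hpos.le, div_mul_cancel₀ _ hq.ne']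
    _ ≤ b i ^ q * (e i * (Q i).real D ^ q) := by gcongr; exact h i
    _ = b i ^ q * e i * (Q i).real D ^ q := by ring
    _ ≤ (Q i).real D ^ q := mul_le_of_le_one_left (by positivity) hi

end PoissonSuspension

end

theorem lemma1p3_general {X : Type*} [MeasurableSpace X] [MeasurableSpace.CountablySeparated X]
    (μ : Measure X) [SigmaFinite μ] (Γ : Subgroup (Aut μ)) [Countable Γ] {q : ℝ} (hq : 0 < q)
    (hΓ : ∀ γ ∈ Γ, γ ∈ Aut₁ μ)
    (hint : ∀ γ ∈ Γ, Integrable (fun x => (μ.rnDeriv (compAut μ γ) x).toReal ^ q - 1) μ)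
    (b : Γ → ℝ) (hb : ∀ γ, 0 ≤ b γ) (hbsum : ¬ Summable b)
    (hbexp : Summable fun γ : Γ => b γ ^ q * Real.exp (q * χ μ (γ : Aut μ) +
      ∫ x, ((μ.rnDeriv (compAut μ (γ : Aut μ)) x).toReal ^ q - 1) ∂μ)) :
    ∃ φ : Γ →* Aut (poisson μ),
      (∀ γ : Γ, IsSuspension (γ : Aut μ) (φ γ)) ∧ IsConservative φ.range := by
  have hac : ∀ γ ∈ Γ, poisson μ ≪ (poisson μ).map (suspensionPerm γ).symm := fun γ hγ =>
    absolutelyContinuous_of_real_rpow_add_one_le hq fun _ =>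
      poisson_real_rpow_add_one_le (hΓ γ hγ) hq.le (hint γ hγ)
  have hns : ∀ γ ∈ Γ, suspensionPerm γ ∈ nonsingularPerm (poisson μ) := fun γ hγ =>
    suspensionPerm_mem_nonsingularPerm γ (hac γ hγ) (hac γ⁻¹ (Γ.inv_mem hγ))
  refine ⟨suspensionHom Γ hns, isSuspension_suspensionHom hns,
    isConservative_range_suspensionHom hns fun D hD hD0 => ?_⟩
  exact tsum_measure_eq_top_of_rpow_add_one_le hq hb hbsum hbexp hD0 fun γ =>
    poisson_real_rpow_add_one_le (hΓ _ γ.2) hq.le (hint _ γ.2) hD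

/-- The existential asserts that the suspensions `γ_*` are elements of `Aut(X*, μ*)` and that
`γ ↦ γ_*` is a homomorphism; the group `Γ_*` is its range. -/
theorem lemma1p3 {X : Type*} [MeasurableSpace X] [StandardBorelSpace X]
    (μ : Measure X) [SigmaFinite μ] [NullSingletonClass μ]
    (Γ : Subgroup (Aut μ)) [Countable Γ]
    (hΓ : ∀ γ ∈ Γ, γ ∈ Aut₁ μ)
    (hχ : ∀ γ ∈ Γ, χ μ γ = 0)
    (hint : ∀ γ ∈ Γ, Integrable (fun x => (μ.rnDeriv (compAut μ γ) x).toReal ^ 2 - 1) μ)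
    (b : Γ → ℝ) (hb : ∀ γ, 0 < b γ) (hbsum : ¬ Summable b)
    (hbexp : Summable fun γ : Γ =>
      b γ ^ 2 * Real.exp (∫ x, ((μ.rnDeriv (compAut μ (γ : Aut μ)) x).toReal ^ 2 - 1) ∂μ)) :
    ∃ φ : Γ →* Aut (poisson μ),
      (∀ γ : Γ, IsSuspension (γ : Aut μ) (φ γ)) ∧ IsConservative φ.range :=
  lemma1p3_general μ Γ two_pos hΓ (by simpa using hint) b (fun γ => (hb γ).le) hbsum
    (by simpa [hχ _ (Subtype.prop _)] using hbexp)
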